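/- Conventions. For a real Banach space $X$, an operator $A:X\rightrightarrows X^*$ is identified with its graph $\operatorname{gra}A\subseteq X\times X^*$, and $X$ with its canonical image in $X^{**}$. $A$ is *monotone* if $\langle x-y,x^*-y^*\rangle\ge 0$ for all $(x,x^*),(y,y^*)\in\operatorname{gra}A$, and *maximally monotone* if moreover it has no proper monotone extension in $X\times X^*$; (maximal) monotonicity of subsets of $X^{**}\times X^*$ is defined in the same way. $A$ is a *linear relation* if $\operatorname{gra}A$ is a linear subspace. The adjoint is given by $\operatorname{gra}A^*=\{(x^{**},x^*)\in X^{**}\times X^*:\langle x^*,a\rangle-\langle x^{**},a^*\rangle=0\ \ \forall (a,a^*)\in\operatorname{gra}A\}$, and $A$ is *skew* if $\operatorname{gra}A\subseteq\operatorname{gra}(-A^*)$. A maximally monotone $A$ is * *of type (D)* if for every $(x^{**},x^*)\in X^{**}\times X^*$ with $\inf_{(a,a^*)\in\operatorname{gra}A}\langle a-x^{**},a^*-x^*\rangle\ge 0$ there is a bounded net in $\operatorname{gra}A$ that converges weak$^*\times$strongly to $(x^{**},x^*)$; * *of type (BR)* if whenever $(x,x^*)\in X\times X^*$, $\alpha,\beta>0$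 and $\inf_{(a,a^*)\in\operatorname{gra}A}\langle x-a,x^*-a^*\rangle>-\alpha\beta$, there is $(b,b^*)\in\operatorname{gra}A$ with $\|x-b\|<\alpha$ and $\|x^*-b^*\|<\beta$; * *unique* if all maximally monotone extensions of $A$ in $X^{**}\times X^*$ coincide. A Banach space is *of type (D)* if every maximally monotone operator on it is of type (D). The *James space* $\mathbf J$ consists of the real sequences $x=(x_n)_{n\ge1}$ with $x_n\to0$ and $$\|x\|:=\sup_{n_1<\cdots<n_k}\Big(\sum_{j=1}^{k-1}(x_{n_j}-x_{n_{j+1}})^2\Big)^{1/2}<\infty .$$ **Theorem.** Let $e_n\in\mathbf J$ be the $n$-th unit vector. Then: 1. $(e_n)_{n\ge1}$ is a Schauder basis of $\mathbf J$, and the partial sums $\sum_{i=1}^n e_i$ converge weak$^*$ in $\mathbf J^{**}$ to some $e\in\mathbf J^{**}$. 2. Let $A:\mathbf J\rightrightarrows\mathbf J^*$ be the operator $$\operatorname{gra}A=\Big\{\Big(\sum_{n}\Big(-\sum_{i>n}\langle e_i,y^*\rangle+\sum_{i<n}\langle e_i,y^*\rangle\Big)e_n,\ y^*\Big)\in\mathbf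 J\times\mathbf J^*\ :\ y^*\in\mathbf J^*,\ \langle e,y^*\rangle=0\Big\},$$ where the series are limits of their partial sums in the natural order and only those $y^*$ are admitted for which they converge (in norm, for the outer series). Then $A$ is a maximally monotone, linear and skew operator; it is not of type (BR), not unique, and not of type (D). 3. Every real Banach space that contains an isomorphic copy of $\mathbf J$ (that is, a linear subspace linearly homeomorphic to $\mathbf J$) is not of type (D). -/

import Mathlib

open Filter Topology

universe u

noncomputable section

/-! ### Set-valued operators `X ⇉ X*`, represented by their graphs in `X × X*` -/

namespace MonotoneOp

variable {X : Type u} [NormedAddCommGroup X] [NormedSpace ℝ X]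

/-- The graph `A ⊆ X × X*` is monotone. -/
def IsMonotone (A : Set (X × StrongDual ℝ X)) : Prop :=
  ∀ p ∈ A, ∀ q ∈ A, 0 ≤ (p.2 - q.2) (p.1 - q.1)

/-- `A` is monotone and has no proper monotone extension in `X × X*`. -/
def IsMaximallyMonotone (A : Set (X × StrongDual ℝ X)) : Prop :=
  IsMonotone A ∧ ∀ B : Set (X × StrongDual ℝ X), IsMonotone B → A ⊆ B → B = A

/-- `A` is a linear relation: its graph is a linear subspace of `X × X*`. -/
def IsLinearRelation (A : Set (X × StrongDual ℝ X)) : Prop :=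
  ∃ S : Submodule ℝ (X × StrongDual ℝ X), (S : Set (X × StrongDual ℝ X)) = A

/-- The graph, in `X** × X*`, of the adjoint `A*`: the pairs `(x**, x*)` such that `(x*, -x**)`
annihilates the graph of `A`. -/
def adjoint (A : Set (X × StrongDual ℝ X)) :
    Set (StrongDual ℝ (StrongDual ℝ X) × StrongDual ℝ X) :=
  {p | ∀ q ∈ A, p.2 q.1 + (-p.1) q.2 = 0}

/-- `A` is skew: the graph of `A` is contained in the graph of `-A*`, where `X` is identified with
its canonical image in `X**`. -/
def IsSkew (A : Set (X × StrongDual ℝ X)) : Prop :=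
  ∀ p ∈ A, (NormedSpace.inclusionInDoubleDual ℝ X p.1, -p.2) ∈ adjoint A

/-- The defining property of operators of dense type, type (D), for a maximally monotone `A`.
Infima are taken in the extended reals. Convergence of `(a γ).1` to `x**` is weak* convergence in
`X**`, and convergence of `(a γ).2` to `x*` is norm convergence. -/
def IsTypeD (A : Set (X × StrongDual ℝ X)) : Prop :=
  ∀ (x'' : StrongDual ℝ (StrongDual ℝ X)) (x' : StrongDual ℝ X),
    (0 : EReal) ≤ ⨅ p ∈ A,
      (((NormedSpace.inclusionInDoubleDual ℝ X p.1 - x'') (p.2 - x') : ℝ) : EReal) →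
    ∃ (Γ : Type u) (_ : Preorder Γ) (_ : IsDirectedOrder Γ) (_ : Nonempty Γ)
      (a : Γ → X × StrongDual ℝ X),
      (∀ γ, a γ ∈ A) ∧ Bornology.IsBounded (Set.range a) ∧
      (∀ y' : StrongDual ℝ X, Tendsto (fun γ => y' (a γ).1) atTop (𝓝 (x'' y'))) ∧
      Tendsto (fun γ => (a γ).2) atTop (𝓝 x')

/-- The Brønsted-Rockafellar property, type (BR), for a maximally monotone `A`. -/
def IsTypeBR (A : Set (X × StrongDual ℝ X)) : Prop :=
  ∀ (x : X) (x' : StrongDual ℝ X) (α β : ℝ), 0 < α → 0 < β →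
    ((-(α * β) : ℝ) : EReal) < ⨅ p ∈ A, (((x' - p.2) (x - p.1) : ℝ) : EReal) →
    ∃ p ∈ A, ‖x - p.1‖ < α ∧ ‖x' - p.2‖ < β

/-- A subset of `X** × X*` is monotone. -/
def IsMonotoneBidual (B : Set (StrongDual ℝ (StrongDual ℝ X) × StrongDual ℝ X)) : Prop :=
  ∀ p ∈ B, ∀ q ∈ B, 0 ≤ (p.1 - q.1) (p.2 - q.2)

/-- A subset of `X** × X*` is maximally monotone. -/
def IsMaximallyMonotoneBidual
    (B : Set (StrongDual ℝ (StrongDual ℝ X) × StrongDual ℝ X)) : Prop :=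
  IsMonotoneBidual B ∧
    ∀ C : Set (StrongDual ℝ (StrongDual ℝ X) × StrongDual ℝ X),
      IsMonotoneBidual C → B ⊆ C → C = B

/-- The graph of `A`, regarded as a subset of `X** × X*`. -/
def bidualGraph (A : Set (X × StrongDual ℝ X)) :
    Set (StrongDual ℝ (StrongDual ℝ X) × StrongDual ℝ X) :=
  (fun p => (NormedSpace.inclusionInDoubleDual ℝ X p.1, p.2)) '' A

/-- `A` is unique: all maximally monotone extensions of `A` in `X** × X*` coincide. -/
def IsUnique (A : Set (X × StrongDual ℝ X)) : Prop :=
  ∀ B C : Set (StrongDual ℝ (StrongDual ℝ X) × StrongDual ℝ X),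
    IsMaximallyMonotoneBidual B → bidualGraph A ⊆ B →
    IsMaximallyMonotoneBidual C → bidualGraph A ⊆ C → B = C

/-- The space `X` is of type (D): every maximally monotone operator on it is of type (D). -/
def IsSpaceOfTypeD (X : Type u) [NormedAddCommGroup X] [NormedSpace ℝ X] : Prop :=
  ∀ A : Set (X × StrongDual ℝ X), IsMaximallyMonotone A → IsTypeD A

/-- The operator with graph
`{(∑ₙ (-∑_{i>n} ⟨bᵢ, y*⟩ + ∑_{i<n} ⟨bᵢ, y*⟩) bₙ, y*) ∈ X × X* : ⟨e, y*⟩ = 0}`.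
All series are limits of their partial sums in the natural order; `t n` is `∑_{i>n} ⟨bᵢ, y*⟩`. -/
def schauderOperator (b : ℕ → X) (e : StrongDual ℝ (StrongDual ℝ X)) :
    Set (X × StrongDual ℝ X) :=
  {p | e p.2 = 0 ∧ ∃ t : ℕ → ℝ,
    (∀ n, Tendsto (fun N => ∑ i ∈ Finset.Ioc n N, p.2 (b i)) atTop (𝓝 (t n))) ∧
    Tendsto (fun N => ∑ n ∈ Finset.range N, (-t n + ∑ i ∈ Finset.range n, p.2 (b i)) • b n)
      atTop (𝓝 p.1)}

end MonotoneOp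

/-! ### The James space -/

namespace James

/-- `√((x_{n₀} - x_{n₁})² + ⋯ + (x_{n_{k-1}} - x_{n_k})²)`, for a strictly increasing sequence of
indices, of which only the first `k + 1` matter. -/
def variation (x : ℕ → ℝ) (p : ℕ × {n : ℕ → ℕ // StrictMono n}) : ℝ :=
  √(∑ i ∈ Finset.range p.1, (x (p.2.1 i) - x (p.2.1 (i + 1))) ^ 2)

theorem variation_add (x y : ℕ → ℝ) (p) :
    variation (x + y) p ≤ variation x p + variation y p := by
  have h : ∀ z : ℕ → ℝ, variation z p =
      ‖WithLp.toLp 2 (fun i : Fin p.1 => z (p.2.1 i) - z (p.2.1 (i + 1)))‖ := by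
    intro z
    rw [EuclideanSpace.norm_eq, variation, Finset.sum_range]
    simp
  rw [h, h, h]
  refine le_trans (le_of_eq ?_) (norm_add_le _ _)
  congr 1
  ext i
  simp
  ring

theorem variation_smul (c : ℝ) (x : ℕ → ℝ) (p) :
    variation (c • x) p = |c| * variation x p := by
  have : ∀ i, ((c • x) (p.2.1 i) - (c • x) (p.2.1 (i + 1))) ^ 2
      = c ^ 2 * (x (p.2.1 i) - x (p.2.1 (i + 1))) ^ 2 := by
    intro i; simp only [Pi.smul_apply, smul_eq_mul]; ring
  unfold variation
  rw [Finset.sum_congr rfl fun i _ => this i, ← Finset.mul_sum, Real.sqrt_mul (sq_nonneg c),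
    Real.sqrt_sq_eq_abs]

theorem variation_zero (p) : variation 0 p = 0 := by simp [variation]

theorem variation_nonneg (x) (p) : 0 ≤ variation x p := Real.sqrt_nonneg _

/-- The sequences that tend to `0` and whose James norm is finite. -/
def submodule : Submodule ℝ (ℕ → ℝ) where
  carrier := {x | Tendsto x atTop (𝓝 0) ∧ BddAbove (Set.range (variation x))}
  add_mem' := by
    rintro x y ⟨hx, Cx, hCx⟩ ⟨hy, Cy, hCy⟩
    refine ⟨by simpa [Pi.add_def] using hx.add hy, Cx + Cy, ?_⟩
    rintro _ ⟨p, rfl⟩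
    exact (variation_add x y p).trans (add_le_add (hCx ⟨p, rfl⟩) (hCy ⟨p, rfl⟩))
  zero_mem' := ⟨tendsto_const_nhds, 0, by rintro _ ⟨p, rfl⟩; exact (variation_zero p).le⟩
  smul_mem' := by
    rintro c x ⟨hx, C, hC⟩
    refine ⟨by simpa [Pi.smul_def] using hx.const_mul c, |c| * C, ?_⟩
    rintro _ ⟨p, rfl⟩
    rw [variation_smul]
    exact mul_le_mul_of_nonneg_left (hC ⟨p, rfl⟩) (abs_nonneg c)

end James

/-- The James space. -/
def JamesSpace : Type := James.submodule

namespace JamesSpace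

open James

instance : AddCommGroup JamesSpace := inferInstanceAs (AddCommGroup James.submodule)

instance : Module ℝ JamesSpace := inferInstanceAs (Module ℝ James.submodule)

/-- The sequence of coordinates of an element of the James space. -/
def seq : JamesSpace →ₗ[ℝ] (ℕ → ℝ) := James.submodule.subtype

theorem seq_injective : Function.Injective seq := Subtype.val_injective

theorem tendsto_seq (x : JamesSpace) : Tendsto (seq x) atTop (𝓝 0) := x.2.1

theorem bddAbove_variation (x : JamesSpace) : BddAbove (Set.range (variation (seq x))) := x.2.2

instance : Nonempty {n : ℕ → ℕ // StrictMono n} := ⟨⟨id, strictMono_id⟩⟩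

/-- The James norm `‖x‖`. -/
def jamesNorm (x : JamesSpace) : ℝ := ⨆ p, variation (seq x) p

theorem variation_le (x : JamesSpace) (p) : variation (seq x) p ≤ jamesNorm x :=
  le_ciSup (bddAbove_variation x) p

theorem abs_sub_le (x : JamesSpace) {i j : ℕ} (h : i < j) :
    |seq x i - seq x j| ≤ jamesNorm x := by
  refine le_trans (le_of_eq ?_) (variation_le x (1, ⟨fun k => if k = 0 then i else j + k - 1, ?_⟩))
  · simp [variation, Real.sqrt_sq_eq_abs]
  · refine strictMono_nat_of_lt_succ fun k => ?_
    rcases k with _ | k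
    · simpa using h
    · simp

theorem abs_seq_le (x : JamesSpace) (i : ℕ) : |seq x i| ≤ jamesNorm x := by
  have h : Tendsto (fun j => |seq x i - seq x j|) atTop (𝓝 |seq x i|) := by
    simpa using ((tendsto_const_nhds (x := seq x i)).sub (tendsto_seq x)).abs
  refine le_of_tendsto h ?_
  filter_upwards [eventually_gt_atTop i] with j hj using abs_sub_le x hj

instance : NormedAddCommGroup JamesSpace :=
  AddGroupNorm.toNormedAddCommGroup
    { toFun := jamesNorm
      map_zero' := by simp [jamesNorm, variation_zero]
      add_le' := fun x y => ciSup_le fun p => by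
        rw [map_add]
        exact (variation_add _ _ p).trans (add_le_add (variation_le x p) (variation_le y p))
      neg' := fun x => by
        have h : ∀ p, variation (seq (-x)) p = variation (seq x) p := fun p => by
          have := variation_smul (-1) (seq x) p
          simpa using this
        exact iSup_congr h
      eq_zero_of_map_eq_zero' := fun x hx => by
        apply seq_injective
        ext i
        have h := abs_seq_le x i
        rw [hx] at h
        simpa using h }

theorem norm_def (x : JamesSpace) : ‖x‖ = ⨆ p, variation (seq x) p := rfl

instance : NormedSpace ℝ JamesSpace where
  norm_smul_le c x := ciSup_le fun p => by
    rw [map_smul, variation_smul]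
    exact mul_le_mul_of_nonneg_left (variation_le x p) (abs_nonneg c)

/-- The James space is a Banach space. -/
instance : CompleteSpace JamesSpace := by
  refine Metric.complete_of_cauchySeq_tendsto fun u hu => ?_
  have hco : ∀ i, CauchySeq fun m => seq (u m) i := by
    intro i
    rw [Metric.cauchySeq_iff] at hu ⊢
    intro ε hε
    obtain ⟨N, hN⟩ := hu ε hε
    refine ⟨N, fun m hm n hn => lt_of_le_of_lt ?_ (hN m hm n hn)⟩
    rw [Real.dist_eq, dist_eq_norm_sub]
    have := abs_seq_le (u m - u n) i
    rwa [map_sub] at this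
  choose x hx using fun i => cauchySeq_tendsto_of_complete (hco i)
  have hvar : ∀ ε > 0, ∃ N, ∀ m ≥ N, ∀ p, variation (seq (u m) - x) p ≤ ε := by
    intro ε hε
    obtain ⟨N, hN⟩ := Metric.cauchySeq_iff.1 hu ε hε
    refine ⟨N, fun m hm p => ?_⟩
    have hlim : Tendsto (fun n => variation (seq (u m) - seq (u n)) p) atTop
        (𝓝 (variation (seq (u m) - x) p)) := by
      refine (Real.continuous_sqrt.tendsto _).comp (tendsto_finsetSum _ fun i _ => ?_)
      exact ((tendsto_const_nhds.sub (hx _)).sub (tendsto_const_nhds.sub (hx _))).pow 2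
    refine le_of_tendsto hlim ?_
    filter_upwards [eventually_ge_atTop N] with n hn
    have h1 := variation_le (u m - u n) p
    rw [map_sub] at h1
    have h2 := hN m hm n hn
    rw [dist_eq_norm] at h2
    exact h1.trans h2.le
  have hunif : ∀ ε > 0, ∃ N, ∀ m ≥ N, ∀ i, |seq (u m) i - x i| ≤ ε := by
    intro ε hε
    obtain ⟨N, hN⟩ := Metric.cauchySeq_iff.1 hu ε hε
    refine ⟨N, fun m hm i => ?_⟩
    refine le_of_tendsto (tendsto_const_nhds.sub (hx i)).abs ?_
    filter_upwards [eventually_ge_atTop N] with n hn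
    have h1 := abs_seq_le (u m - u n) i
    rw [map_sub] at h1
    have h2 := hN m hm n hn
    rw [dist_eq_norm] at h2
    exact h1.trans h2.le
  have hx0 : Tendsto x atTop (𝓝 0) := by
    rw [Metric.tendsto_atTop]
    intro ε hε
    obtain ⟨N, hN⟩ := hunif (ε / 2) (half_pos hε)
    obtain ⟨M, hM⟩ := Metric.tendsto_atTop.1 (tendsto_seq (u N)) (ε / 2) (half_pos hε)
    refine ⟨M, fun i hi => ?_⟩
    have h1 := abs_le.1 (hN N le_rfl i)
    have h2 := hM i hi
    rw [Real.dist_eq, sub_zero, abs_lt] at h2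
    rw [Real.dist_eq, sub_zero, abs_lt]
    constructor <;> linarith [h1.1, h1.2, h2.1, h2.2]
  have hxb : BddAbove (Set.range (variation x)) := by
    obtain ⟨N, hN⟩ := hvar 1 one_pos
    refine ⟨jamesNorm (u N) + 1, ?_⟩
    rintro _ ⟨p, rfl⟩
    have h1 := variation_add (seq (u N)) (-(seq (u N) - x)) p
    have h2 := variation_smul (-1) (seq (u N) - x) p
    rw [neg_one_smul, abs_neg, abs_one, one_mul] at h2
    rw [h2] at h1
    have h3 : seq (u N) + -(seq (u N) - x) = x := by abel
    rw [h3] at h1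
    linarith [hN N le_rfl p, variation_le (u N) p]
  let y : JamesSpace := (⟨x, hx0, hxb⟩ : James.submodule)
  have hy : seq y = x := rfl
  refine ⟨y, Metric.tendsto_atTop.2 fun ε hε => ?_⟩
  obtain ⟨N, hN⟩ := hvar (ε / 2) (half_pos hε)
  refine ⟨N, fun m hm => ?_⟩
  rw [dist_eq_norm]
  refine lt_of_le_of_lt (ciSup_le fun p => ?_) (half_lt_self hε)
  rw [map_sub, hy]
  exact hN m hm p

theorem single_mem (n : ℕ) : (Pi.single n 1 : ℕ → ℝ) ∈ James.submodule := by
  refine ⟨?_, √2, ?_⟩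
  · refine tendsto_const_nhds.congr' ?_
    filter_upwards [eventually_gt_atTop n] with i hi
    simp [hi.ne']
  · rintro _ ⟨⟨k, f, hf⟩, rfl⟩
    refine Real.sqrt_le_sqrt ?_
    have key : ∀ g : ℕ → ℕ, Function.Injective g →
        ∑ i ∈ Finset.range k, (Pi.single n 1 : ℕ → ℝ) (g i) ≤ 1 := by
      intro g hg
      rw [← Finset.sum_image (f := (Pi.single n 1 : ℕ → ℝ)) fun a _ b _ h => hg h]
      simp only [Pi.single_apply, Finset.sum_ite_eq']
      split_ifs <;> norm_num
    have h1 := key f hf.injective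
    have h2 := key (fun i => f (i + 1)) fun a b h => by
      have := hf.injective h
      omega
    have : ∀ i, ((Pi.single n 1 : ℕ → ℝ) (f i) - (Pi.single n 1 : ℕ → ℝ) (f (i + 1))) ^ 2 ≤
        (Pi.single n 1 : ℕ → ℝ) (f i) + (Pi.single n 1 : ℕ → ℝ) (f (i + 1)) := by
      intro i
      simp only [Pi.single_apply]
      split_ifs <;> norm_num
    calc _ ≤ _ := Finset.sum_le_sum fun i _ => this i
      _ ≤ 2 := by rw [Finset.sum_add_distrib]; linarith

/-- The `n`-th unit vector `(0, …, 0, 1, 0, …)`. -/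
def unitVec (n : ℕ) : JamesSpace := (⟨Pi.single n 1, single_mem n⟩ : James.submodule)

end JamesSpace

end

/-! A sum of squared differences is at most the oscillation times the total variation. Hence a step
vector with K blocks and values in [-1, 1] has James norm at most 2√K. If the partial sums s_n of
y(e_0) + y(e_1) + ⋯ moved by ε on infinitely many disjoint blocks, a suitable choice of signs would
give Kε ≤ 2‖y‖√K for all K. So s_n converges for every y (`cauchySeq_partialSum`), and
Banach–Steinhaus makes the limit e(y) a bounded functional of y.

When e(y) = 0, the tail of the series after n is -s_{n+1}, so membership of (x, y) in the operator
means e(y) = 0 and x_n = s_n + s_{n+1} (`mem_schauderOperator_iff`). Then x_n y(e_n) = s_{n+1}² -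
s_n² telescopes and y(x) = 0, which yields skewness. A pair (x, y) monotonically related to the
operator annihilates it, which forces x_n = s_n + s_{n+1} - 2e(y) and therefore y(x) = -e(y)². Since
also y(x) ≥ 0, e(y) = 0: the operator is maximal.

The three failures come from e vanishing on the range of the operator although e(`coord 0`) = 1. In
particular (e, 0) is related to the operator, but |x_n| ≤ 2‖y‖ on the graph keeps nets with y → 0
away from e. A closed embedding L of the James space carries the operator to a maximally monotone
one with the same defect (`not_isTypeD_pushforward`). -/

noncomputable section

/-! ### Norm estimates and the weak* limit of the partial sums -/

namespace JamesSpace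

open James

theorem seq_unitVec (n : ℕ) : seq (unitVec n) = Pi.single n 1 := rfl

/-- One factor of each square is bounded by D; the remaining factors sum to at most the total
variation, by the triangle inequality between successive indices of the chain. -/
theorem norm_le_sqrt_mul {x : JamesSpace} {D T : ℝ} (hD : ∀ i j, |seq x i - seq x j| ≤ D)
    (hT : ∀ M, ∑ i ∈ Finset.range M, |seq x i - seq x (i + 1)| ≤ T) : ‖x‖ ≤ √(D * T) := by
  have hD0 : 0 ≤ D := (abs_nonneg _).trans (hD 0 0)
  refine ciSup_le fun ⟨k, f, hf⟩ => Real.sqrt_le_sqrt ?_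
  have h : ∀ k, ∑ j ∈ Finset.range k, |seq x (f j) - seq x (f (j + 1))| ≤
      ∑ i ∈ Finset.range (f k), |seq x i - seq x (i + 1)| := by
    intro k
    induction k with
    | zero => simpa using Finset.sum_nonneg fun i _ => abs_nonneg _
    | succ k ih =>
      rw [Finset.sum_range_succ]
      have h1 := dist_le_Ico_sum_dist (seq x) (hf.monotone k.le_succ)
      simp only [Real.dist_eq] at h1
      have h2 := Finset.sum_range_add_sum_Ico (fun i => |seq x i - seq x (i + 1)|)
        (hf.monotone k.le_succ)
      simp only [Nat.succ_eq_add_one] at h1 h2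
      linarith
  calc ∑ j ∈ Finset.range k, (seq x (f j) - seq x (f (j + 1))) ^ 2
      ≤ ∑ j ∈ Finset.range k, D * |seq x (f j) - seq x (f (j + 1))| := by
        refine Finset.sum_le_sum fun j _ => ?_
        rw [← sq_abs, sq]
        exact mul_le_mul_of_nonneg_right (hD _ _) (abs_nonneg _)
    _ ≤ D * T := by
        rw [← Finset.mul_sum]
        exact mul_le_mul_of_nonneg_left ((h k).trans (hT _)) hD0

/-- The vector `(1, …, 1, 0, …)` with `n` ones. -/
def initial (n : ℕ) : JamesSpace := ∑ i ∈ Finset.range n, unitVec i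

theorem seq_initial (n i : ℕ) : seq (initial n) i = if i < n then 1 else 0 := by
  simp [initial, map_sum, seq_unitVec, Finset.sum_apply, Pi.single_apply]

theorem sum_abs_initial_le (n M : ℕ) :
    ∑ i ∈ Finset.range M, |seq (initial n) i - seq (initial n) (i + 1)| ≤ 1 := by
  have h : ∀ i, |seq (initial n) i - seq (initial n) (i + 1)| =
      seq (initial n) i - seq (initial n) (i + 1) := by
    intro i
    refine abs_of_nonneg ?_
    simp only [seq_initial]
    split_ifs <;> first | omega | norm_num
  simp only [h, Finset.sum_range_sub']
  simp only [seq_initial]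
  split_ifs <;> norm_num

theorem norm_initial_le (n : ℕ) : ‖initial n‖ ≤ 1 := by
  refine (norm_le_sqrt_mul (D := 1) (T := 1) (fun i j => ?_) (sum_abs_initial_le n)).trans (by simp)
  simp only [seq_initial]
  split_ifs <;> norm_num

/-- The partial sums of the series `∑ y (eᵢ)`. -/
def partialSum (y : StrongDual ℝ JamesSpace) (n : ℕ) : ℝ := ∑ i ∈ Finset.range n, y (unitVec i)

theorem partialSum_eq (y : StrongDual ℝ JamesSpace) (n : ℕ) : partialSum y n = y (initial n) := by
  simp [partialSum, initial]

theorem partialSum_zero (y : StrongDual ℝ JamesSpace) : partialSum y 0 = 0 := by simp [partialSum]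

theorem partialSum_succ (y : StrongDual ℝ JamesSpace) (n : ℕ) :
    partialSum y (n + 1) = partialSum y n + y (unitVec n) := Finset.sum_range_succ _ _

theorem abs_partialSum_le (y : StrongDual ℝ JamesSpace) (n : ℕ) : |partialSum y n| ≤ ‖y‖ := by
  rw [partialSum_eq]
  exact (y.le_opNorm _).trans (mul_le_of_le_one_right (norm_nonneg _) (norm_initial_le n))

/-- The step vector with values `c j` on the blocks `[m j, m (j + 1))`, `j < K`. -/
def step (m : ℕ → ℕ) (c : ℕ → ℝ) (K : ℕ) : JamesSpace :=
  ∑ j ∈ Finset.range K, c j • (initial (m (j + 1)) - initial (m j))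

theorem step_succ (m : ℕ → ℕ) (c : ℕ → ℝ) (K : ℕ) :
    step m c (K + 1) = step m c K + c K • (initial (m (K + 1)) - initial (m K)) :=
  Finset.sum_range_succ _ _

/-- The vanishing beyond `m K` drives the induction: each new block is added where the earlier ones
are zero. -/
theorem abs_seq_step_le {m : ℕ → ℕ} (hm : StrictMono m) {c : ℕ → ℝ} (hc : ∀ j, |c j| ≤ 1)
    (K i : ℕ) : |seq (step m c K) i| ≤ 1 ∧ (m K ≤ i → seq (step m c K) i = 0) := by
  induction K with
  | zero => simp [step]
  | succ K ih =>
    have h := hm K.lt_succ_self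
    simp only [step_succ, map_add, map_smul, map_sub, Pi.add_apply, Pi.smul_apply, Pi.sub_apply,
      seq_initial, smul_eq_mul, Nat.succ_eq_add_one] at h ⊢
    rcases lt_or_ge i (m K) with h1 | h1
    · simp only [h1, h1.trans h, if_true, sub_self, mul_zero, add_zero]
      exact ⟨ih.1, fun h2 => by omega⟩
    · rw [ih.2 h1]
      rcases lt_or_ge i (m (K + 1)) with h2 | h2
      · simp only [h2, h1.not_gt, if_true, if_false, sub_zero, mul_one, zero_add]
        exact ⟨hc K, fun h3 => by omega⟩
      · simp [h2.not_gt, h1.not_gt]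

theorem sum_abs_step_le (m : ℕ → ℕ) {c : ℕ → ℝ} (hc : ∀ j, |c j| ≤ 1) (K M : ℕ) :
    ∑ i ∈ Finset.range M, |seq (step m c K) i - seq (step m c K) (i + 1)| ≤ 2 * K := by
  induction K with
  | zero => simp [step]
  | succ K ih =>
    have h1 := sum_abs_initial_le (m (K + 1)) M
    have h2 := sum_abs_initial_le (m K) M
    have h : ∀ i, |seq (step m c (K + 1)) i - seq (step m c (K + 1)) (i + 1)| ≤
        |seq (step m c K) i - seq (step m c K) (i + 1)| +
        (|seq (initial (m (K + 1))) i - seq (initial (m (K + 1))) (i + 1)| +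
          |seq (initial (m K)) i - seq (initial (m K)) (i + 1)|) := by
      intro i
      set p := seq (initial (m (K + 1))) i - seq (initial (m (K + 1))) (i + 1) with hp
      set q := seq (initial (m K)) i - seq (initial (m K)) (i + 1) with hq
      have : seq (step m c (K + 1)) i - seq (step m c (K + 1)) (i + 1) =
          (seq (step m c K) i - seq (step m c K) (i + 1)) + c K * (p - q) := by
        simp only [hp, hq, step_succ, map_add, map_smul, map_sub, Pi.add_apply, Pi.smul_apply,
          Pi.sub_apply, smul_eq_mul]
        ring
      rw [this]
      refine (abs_add_le _ _).trans (add_le_add_right ?_ _)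
      rw [abs_mul]
      exact (mul_le_of_le_one_left (abs_nonneg _) (hc K)).trans (abs_sub _ _)
    have h3 := Finset.sum_le_sum fun i (_ : i ∈ Finset.range M) => h i
    simp only [Finset.sum_add_distrib] at h3
    push_cast
    linarith

theorem sum_abs_partialSum_sub_le (y : StrongDual ℝ JamesSpace) {m : ℕ → ℕ} (hm : StrictMono m)
    (K : ℕ) :
    ∑ j ∈ Finset.range K, |partialSum y (m (j + 1)) - partialSum y (m j)| ≤ ‖y‖ * √(4 * K) := by
  -- These signs make `y` evaluate on the step vector to the sum of absolute increments.
  let c : ℕ → ℝ := fun j => SignType.sign (partialSum y (m (j + 1)) - partialSum y (m j))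
  have hc : ∀ j, |c j| ≤ 1 := by
    intro j
    simp only [c]
    cases SignType.sign (partialSum y (m (j + 1)) - partialSum y (m j)) <;> simp
  have h1 : y (step m c K) =
      ∑ j ∈ Finset.range K, |partialSum y (m (j + 1)) - partialSum y (m j)| := by
    simp only [step, map_sum, map_smul, map_sub, ← partialSum_eq, smul_eq_mul]
    exact Finset.sum_congr rfl fun j _ => sign_mul_self _
  -- Oscillation at most 2, total variation at most 2K.
  have h2 : ‖step m c K‖ ≤ √(2 * (2 * K)) := by
    refine norm_le_sqrt_mul (fun i j => ?_) (sum_abs_step_le m hc K)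
    refine (abs_sub _ _).trans ?_
    linarith [(abs_seq_step_le hm hc K i).1, (abs_seq_step_le hm hc K j).1]
  rw [← h1]
  refine (le_abs_self _).trans ((y.le_opNorm _).trans (mul_le_mul_of_nonneg_left ?_ (norm_nonneg _)))
  rwa [← mul_assoc, show (2 : ℝ) * 2 = 4 by norm_num] at h2

theorem cauchySeq_partialSum (y : StrongDual ℝ JamesSpace) : CauchySeq (partialSum y) := by
  rw [Metric.cauchySeq_iff']
  by_contra! h
  obtain ⟨ε, hε, h⟩ := h
  choose g hg1 hg2 using h
  have hg3 : ∀ n, n < g n := fun n => (hg1 n).lt_of_ne fun h => by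
    have := hg2 n
    rw [← h, dist_self] at this
    linarith
  -- Iterating `g` yields consecutive blocks, on each of which the partial sums move by at least ε.
  let m : ℕ → ℕ := fun j => g^[j] 0
  have hm1 : ∀ j, m (j + 1) = g (m j) := fun j => Function.iterate_succ_apply' g j 0
  have hm : StrictMono m := strictMono_nat_of_lt_succ fun j => by rw [hm1]; exact hg3 _
  have hK : ∀ K : ℕ, K * ε ≤ ‖y‖ * √(4 * K) := fun K => by
    refine le_trans ?_ (sum_abs_partialSum_sub_le y hm K)
    rw [← nsmul_eq_mul, ← Finset.card_range K, ← Finset.sum_const, Finset.card_range]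
    refine Finset.sum_le_sum fun j _ => ?_
    rw [hm1]
    exact hg2 (m j)
  -- Squaring Kε ≤ ‖y‖√(4K) gives Kε² ≤ 4‖y‖² for K > 0, which this K violates.
  obtain ⟨K, hK1⟩ := exists_nat_gt (4 * ‖y‖ ^ 2 / ε ^ 2)
  rw [div_lt_iff₀ (by positivity)] at hK1
  have hK0 : (0 : ℝ) < K := by
    rcases K.eq_zero_or_pos with rfl | h
    · have := sq_nonneg ‖y‖
      simp only [Nat.cast_zero, zero_mul] at hK1
      linarith
    · exact_mod_cast h
  have h1 := pow_le_pow_left₀ (by positivity) (hK K) 2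
  rw [mul_pow, mul_pow, Real.sq_sqrt (by positivity)] at h1
  have := mul_lt_mul_of_pos_left hK1 hK0
  nlinarith

theorem exists_tendsto_partialSum : ∃ e : StrongDual ℝ (StrongDual ℝ JamesSpace),
    ∀ y, Tendsto (partialSum y) atTop (𝓝 (e y)) := by
  choose f hf using fun y => cauchySeq_tendsto_of_complete (cauchySeq_partialSum y)
  refine ⟨continuousLinearMapOfTendsto (l := atTop)
    (fun n => NormedSpace.inclusionInDoubleDual ℝ JamesSpace (initial n)) (f := f)
    (tendsto_pi_nhds.2 fun y => ?_), fun y => hf y⟩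
  simpa only [NormedSpace.dual_def, ← partialSum_eq] using hf y

/-! ### Small tails of the quadratic variation and the Schauder basis -/

theorem exists_forall_sum_sq_le (x : JamesSpace) {ε : ℝ} (hε : 0 < ε) :
    ∃ N, ∀ (k : ℕ) (f : ℕ → ℕ), StrictMono f → N ≤ f 0 →
      ∑ i ∈ Finset.range k, (seq x (f i) - seq x (f (i + 1))) ^ 2 ≤ ε := by
  let S : Set ℝ := Set.range fun p : ℕ × {n : ℕ → ℕ // StrictMono n} =>
    ∑ i ∈ Finset.range p.1, (seq x (p.2.1 i) - seq x (p.2.1 (i + 1))) ^ 2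
  have hS : BddAbove S := by
    refine ⟨jamesNorm x ^ 2, ?_⟩
    rintro _ ⟨p, rfl⟩
    exact (Real.sqrt_le_iff.1 (variation_le x p)).2
  -- A chain within ε of the supremum: any chain starting after its end can be appended to it, so it
  -- contributes at most ε.
  obtain ⟨_, ⟨⟨k, f, hf⟩, rfl⟩, h⟩ := exists_lt_of_lt_csSup (s := S)
    (Set.range_nonempty _) (sub_lt_self (sSup S) hε)
  refine ⟨f k + 1, fun l g hg hN => ?_⟩
  let r : ℕ → ℕ := fun i => if i ≤ k then f i else g (i - (k + 1))
  have hr : StrictMono r := by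
    refine strictMono_nat_of_lt_succ fun i => ?_
    rcases lt_trichotomy i k with hi | rfl | hi
    · simpa [r, hi.le, Nat.succ_le_of_lt hi] using hf i.lt_succ_self
    · simpa [r] using hN
    · simp only [r, hi.not_ge, (hi.trans i.lt_succ_self).not_ge, if_false]
      exact hg (by omega)
  -- Of the k + 1 + l differences, k come from `f`, l from `g`, and one is the nonnegative link
  -- between them.
  have h1 := le_csSup hS ⟨(k + 1 + l, ⟨r, hr⟩), rfl⟩
  simp only [Finset.sum_range_add, Finset.sum_range_succ] at h1
  have h2 : ∑ i ∈ Finset.range k, (seq x (r i) - seq x (r (i + 1))) ^ 2 =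
      ∑ i ∈ Finset.range k, (seq x (f i) - seq x (f (i + 1))) ^ 2 := by
    refine Finset.sum_congr rfl fun i hi => ?_
    rw [Finset.mem_range] at hi
    simp [r, hi.le, Nat.succ_le_of_lt hi]
  have h3 : ∑ i ∈ Finset.range l, (seq x (r (k + 1 + i)) - seq x (r (k + 1 + i + 1))) ^ 2 =
      ∑ i ∈ Finset.range l, (seq x (g i) - seq x (g (i + 1))) ^ 2 := by
    refine Finset.sum_congr rfl fun i hi => ?_
    have e1 : r (k + 1 + i) = g i := by
      simp only [r, show ¬ k + 1 + i ≤ k by omega, if_false]; congr 1; omega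
    have e2 : r (k + 1 + i + 1) = g (i + 1) := by
      simp only [r, show ¬ k + 1 + i + 1 ≤ k by omega, if_false]; congr 1; omega
    rw [e1, e2]
  rw [h2, h3] at h1
  simp only at h
  linarith [sq_nonneg (seq x (r k) - seq x (r (k + 1)))]

theorem seq_sum_unitVec (x : ℕ → ℝ) (N i : ℕ) :
    seq (∑ n ∈ Finset.range N, x n • unitVec n) i = if i < N then x i else 0 := by
  simp [map_sum, seq_unitVec, Finset.sum_apply, Pi.single_apply]

theorem tendsto_sum_unitVec (x : JamesSpace) :
    Tendsto (fun N => ∑ n ∈ Finset.range N, seq x n • unitVec n) atTop (𝓝 x) := by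
  rw [tendsto_iff_norm_sub_tendsto_zero]
  rw [Metric.tendsto_atTop]
  intro ε hε
  obtain ⟨N₁, h₁⟩ := exists_forall_sum_sq_le x (ε := ε ^ 2 / 8) (by positivity)
  obtain ⟨N₂, h₂⟩ := Metric.tendsto_atTop.1 (tendsto_seq x) (ε / 4) (by positivity)
  refine ⟨max N₁ N₂, fun N hN => ?_⟩
  have hN₁ : N₁ ≤ N := (le_max_left _ _).trans hN
  have hN₂ : N₂ ≤ N := (le_max_right _ _).trans hN
  rw [Real.dist_eq, sub_zero, abs_norm, norm_sub_rev]
  set z := x - ∑ n ∈ Finset.range N, seq x n • unitVec n with hz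
  have hz1 : ∀ i, i < N → seq z i = 0 := fun i hi => by
    rw [hz, map_sub, Pi.sub_apply, seq_sum_unitVec, if_pos hi, sub_self]
  have hz2 : ∀ i, N ≤ i → seq z i = seq x i := fun i hi => by
    rw [hz, map_sub, Pi.sub_apply, seq_sum_unitVec, if_neg hi.not_gt, sub_zero]
  refine lt_of_le_of_lt (b := ε / 2) (ciSup_le ?_) (half_lt_self hε)
  rintro ⟨k, f, hf⟩
  refine Real.sqrt_le_iff.2 ⟨by positivity, ?_⟩
  have hex : ∃ j, N ≤ f j := ⟨N, hf.le_apply⟩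
  classical
  -- The chain is cut at its first index ≥ N. Before the cut only the jump from 0 into `f j` can be
  -- nonzero; after it `z` agrees with `x`.
  obtain ⟨j, hj, hmin⟩ : ∃ j, N ≤ f j ∧ ∀ i < j, f i < N :=
    ⟨Nat.find hex, Nat.find_spec hex, fun i hi => not_le.1 (Nat.find_min hex hi)⟩
  have hhead : ∑ i ∈ Finset.range j, (seq z (f i) - seq z (f (i + 1))) ^ 2 ≤ ε ^ 2 / 8 := by
    rcases j with _ | j
    · simp only [Finset.range_zero, Finset.sum_empty]; positivity
    · rw [Finset.sum_range_succ, Finset.sum_eq_zero, zero_add, hz1 _ (hmin j j.lt_succ_self),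
        hz2 _ hj, zero_sub, neg_sq]
      · have h := h₂ _ (hN₂.trans hj)
        rw [Real.dist_eq, sub_zero] at h
        have := pow_le_pow_left₀ (abs_nonneg _) h.le 2
        rw [sq_abs] at this
        nlinarith
      · intro i hi
        rw [Finset.mem_range] at hi
        rw [hz1 _ (hmin i (by omega)), hz1 _ (hmin (i + 1) (by omega))]
        norm_num
  have htail : ∑ i ∈ Finset.range k, (seq z (f (j + i)) - seq z (f (j + i + 1))) ^ 2 ≤
      ε ^ 2 / 8 := by
    have h := h₁ k (fun i => f (j + i)) (fun a b hab => hf (by omega)) (hN₁.trans hj)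
    refine le_trans (le_of_eq (Finset.sum_congr rfl fun i _ => ?_)) h
    rw [hz2 _ (hj.trans (hf.monotone (by omega))), hz2 _ (hj.trans (hf.monotone (by omega)))]
    rfl
  calc ∑ i ∈ Finset.range k, (seq z (f i) - seq z (f (i + 1))) ^ 2
      -- Lengthening the chain to j + k differences allows a split at j without comparing j with k.
      ≤ ∑ i ∈ Finset.range (j + k), (seq z (f i) - seq z (f (i + 1))) ^ 2 :=
        Finset.sum_le_sum_of_subset_of_nonneg (Finset.range_subset_range.2 (by omega))
          fun _ _ _ => sq_nonneg _
    _ ≤ (ε / 2) ^ 2 := by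
        rw [Finset.sum_range_add]
        linarith

/-- The coordinate functionals of the James space. -/
def coord (n : ℕ) : StrongDual ℝ JamesSpace :=
  LinearMap.mkContinuous ((LinearMap.proj n).comp seq) 1 fun x => by
    rw [one_mul]
    exact abs_seq_le x n

theorem coord_apply (n : ℕ) (x : JamesSpace) : coord n x = seq x n := rfl

theorem coord_unitVec (n i : ℕ) : coord n (unitVec i) = if n = i then 1 else 0 := by
  rw [coord_apply, seq_unitVec, Pi.single_apply]

/-- The unit vectors form a Schauder basis. -/
def schauderBasis : SchauderBasis ℝ JamesSpace where
  basis := unitVec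
  coord := coord
  ortho i j := by rcases eq_or_ne i j with rfl | h <;> simp [coord_unitVec, *]
  expansion x := by
    rw [HasSum, SummationFilter.conditional_filter_eq_map_range, tendsto_map'_iff]
    exact tendsto_sum_unitVec x

end JamesSpace

/-! ### Monotonically related points and extensions to the bidual -/

namespace MonotoneOp

section General

universe v

variable {X : Type v} [NormedAddCommGroup X] [NormedSpace ℝ X]

theorem exists_isMaximallyMonotoneBidual
    {B : Set (StrongDual ℝ (StrongDual ℝ X) × StrongDual ℝ X)} (hB : IsMonotoneBidual B) :
    ∃ C, IsMaximallyMonotoneBidual C ∧ B ⊆ C := by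
  obtain ⟨C, hBC, hC⟩ := zorn_subset_nonempty {C | IsMonotoneBidual C} (fun c hc hchain _ => by
    refine ⟨⋃₀ c, ?_, fun s hs => Set.subset_sUnion_of_mem hs⟩
    rintro p ⟨s, hs, hps⟩ q ⟨t, ht, hqt⟩
    rcases hchain.total hs ht with h | h
    · exact hc ht p (h hps) q hqt
    · exact hc hs p hps q (h hqt)) B hB
  exact ⟨C, ⟨hC.1, fun D hD hCD => (hC.2 hD hCD).antisymm hCD⟩, hBC⟩

theorem IsMonotone.bidualGraph {A : Set (X × StrongDual ℝ X)} (hA : IsMonotone A) :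
    IsMonotoneBidual (bidualGraph A) := by
  rintro _ ⟨p, hp, rfl⟩ _ ⟨q, hq, rfl⟩
  have h := hA p hp q hq
  simp only [sub_apply, map_sub, NormedSpace.dual_def] at h ⊢
  linarith

theorem IsMonotoneBidual.insert {B : Set (StrongDual ℝ (StrongDual ℝ X) × StrongDual ℝ X)}
    (hB : IsMonotoneBidual B) {p : StrongDual ℝ (StrongDual ℝ X) × StrongDual ℝ X}
    (hp : ∀ q ∈ B, 0 ≤ (q.1 - p.1) (q.2 - p.2)) : IsMonotoneBidual (insert p B) := by
  have hp' : ∀ q ∈ B, 0 ≤ (p.1 - q.1) (p.2 - q.2) := fun q hq => by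
    rw [← neg_sub q.1, ← neg_sub q.2, neg_apply, map_neg, neg_neg]
    exact hp q hq
  rintro q (rfl | hq) r (rfl | hr)
  · simp
  · exact hp' r hr
  · exact hp q hq
  · exact hB q hq r hr

/-- Two points of `X** × X*` that are monotonically related to `A`, but not to each other, lie in
different maximally monotone extensions. -/
theorem not_isUnique {A : Set (X × StrongDual ℝ X)} (hA : IsMonotone A)
    {p q : StrongDual ℝ (StrongDual ℝ X) × StrongDual ℝ X}
    (hp : ∀ r ∈ A, 0 ≤ (NormedSpace.inclusionInDoubleDual ℝ X r.1 - p.1) (r.2 - p.2))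
    (hq : ∀ r ∈ A, 0 ≤ (NormedSpace.inclusionInDoubleDual ℝ X r.1 - q.1) (r.2 - q.2))
    (hpq : (p.1 - q.1) (p.2 - q.2) < 0) : ¬ IsUnique A := by
  intro h
  have key : ∀ p : StrongDual ℝ (StrongDual ℝ X) × StrongDual ℝ X,
      (∀ r ∈ A, 0 ≤ (NormedSpace.inclusionInDoubleDual ℝ X r.1 - p.1) (r.2 - p.2)) →
      ∃ C, IsMaximallyMonotoneBidual C ∧ bidualGraph A ⊆ C ∧ p ∈ C := fun p hp => by
    obtain ⟨C, hC, h⟩ := exists_isMaximallyMonotoneBidual (hA.bidualGraph.insert (p := p) (by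
      rintro _ ⟨r, hr, rfl⟩
      exact hp r hr))
    exact ⟨C, hC, (Set.subset_insert _ _).trans h, h (Set.mem_insert _ _)⟩
  obtain ⟨B, hB, hAB, hpB⟩ := key p hp
  obtain ⟨C, hC, hAC, hqC⟩ := key q hq
  obtain rfl := h B C hB hAB hC hAC
  exact hpq.not_ge (hB.1 p hpB q hqC)

/-- A point that is monotonically related to a skew linear relation annihilates it. -/
theorem annihilates_of_related {A : Submodule ℝ (X × StrongDual ℝ X)}
    (hA : ∀ q ∈ A, q.2 q.1 = 0) {p : X × StrongDual ℝ X}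
    (hp : ∀ q ∈ A, 0 ≤ (p.2 - q.2) (p.1 - q.1)) :
    0 ≤ p.2 p.1 ∧ ∀ q ∈ A, p.2 q.1 + q.2 p.1 = 0 := by
  have h : ∀ q ∈ A, p.2 q.1 + q.2 p.1 ≤ p.2 p.1 := fun q hq => by
    have h1 := hp q hq
    have h2 := hA q hq
    simp only [sub_apply, map_sub] at h1
    linarith
  have h0 : 0 ≤ p.2 p.1 := by simpa using h 0 A.zero_mem
  refine ⟨h0, fun q hq => ?_⟩
  by_contra hne
  -- This multiple of `q` turns the linear left-hand side into `p.2 p.1 + 1`.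
  have h1 := h (((p.2 p.1 + 1) / (p.2 q.1 + q.2 p.1)) • q) (A.smul_mem _ hq)
  simp only [Prod.smul_fst, Prod.smul_snd, map_smul, smul_apply, smul_eq_mul,
    ← mul_add, div_mul_cancel₀ _ hne] at h1
  linarith

end General

/-! ### Transport of maximal monotonicity along a closed embedding -/

section Pushforward

universe v w

variable {X : Type v} [NormedAddCommGroup X] [NormedSpace ℝ X]
  {Y : Type w} [NormedAddCommGroup Y] [NormedSpace ℝ Y]

/-- The operator on `Y` with graph `{(L x, y*) : (x, L* y*) ∈ gra A}`. -/
def pushforward (L : X →L[ℝ] Y) (A : Set (X × StrongDual ℝ X)) : Set (Y × StrongDual ℝ Y) :=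
  {p | ∃ x, L x = p.1 ∧ (x, p.2.comp L) ∈ A}

theorem exists_strongDual_ne_zero {S : Submodule ℝ Y} (hS : IsClosed (S : Set Y)) {y : Y}
    (hy : y ∉ S) : ∃ g : StrongDual ℝ Y, (∀ z ∈ S, g z = 0) ∧ g y ≠ 0 := by
  have : IsClosed (S : Set Y) := hS
  obtain ⟨g, hg⟩ := SeparatingDual.exists_ne_zero (R := ℝ) (x := S.mkQ y)
    (by simpa using hy)
  refine ⟨g.comp S.mkQL, fun z hz => ?_, hg⟩
  have : S.mkQ z = 0 := by simpa using hz
  exact (congrArg g this).trans (map_zero g)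

/-- A functional vanishing on the range of `L` can be added freely to the dual component of a graph
point, so a related point must lie over that range. There the extension hypothesis reduces
everything to maximality of `A`. -/
theorem IsMaximallyMonotone.pushforward {A : Set (X × StrongDual ℝ X)}
    (hA : IsMaximallyMonotone A) (hne : A.Nonempty) (L : X →L[ℝ] Y)
    (hL : IsClosed (L.range : Set Y))
    (hext : ∀ x' : StrongDual ℝ X, ∃ y' : StrongDual ℝ Y, y'.comp L = x') :
    IsMaximallyMonotone (pushforward L A) := by
  have hmono : IsMonotone (MonotoneOp.pushforward L A) := by
    rintro ⟨_, p⟩ ⟨x, rfl, hx⟩ ⟨_, q⟩ ⟨z, rfl, hz⟩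
    simpa using hA.1 _ hx _ hz
  refine ⟨hmono, fun B hB hAB => (Set.Subset.antisymm hAB ?_).symm⟩
  rintro ⟨y, y'⟩ hy
  have hyL : y ∈ L.range := by
    by_contra hyL
    obtain ⟨g, hg, hgy⟩ := exists_strongDual_ne_zero hL hyL
    obtain ⟨⟨a, a'⟩, ha⟩ := hne
    obtain ⟨b', rfl⟩ := hext a'
    have h : ∀ t : ℝ, 0 ≤ (y' - (b' + t • g)) (y - L a) := fun t => by
      refine hB _ hy (L a, b' + t • g) (hAB ⟨a, rfl, ?_⟩)
      convert ha using 2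
      ext x
      simp [hg (L x) ⟨x, rfl⟩]
    -- For this `t` the nonnegative quantity in `h` equals -1.
    have h1 := h (((y' - b') (y - L a) + 1) / g y)
    simp only [sub_apply, add_apply,
      smul_apply, map_sub, hg (L a) ⟨a, rfl⟩, smul_eq_mul,
      div_mul_cancel₀ _ hgy] at h1
    linarith
  obtain ⟨x, rfl⟩ := hyL
  refine ⟨x, rfl, ?_⟩
  have h := hA.2 (insert (x, y'.comp L) A) ?_ (Set.subset_insert _ _)
  · rw [← h]
    exact Set.mem_insert _ _
  have hx : ∀ q ∈ A, 0 ≤ (y'.comp L - q.2) (x - q.1) := by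
    rintro ⟨a, a'⟩ ha
    obtain ⟨b', rfl⟩ := hext a'
    simpa using hB _ hy (L a, b') (hAB ⟨a, rfl, ha⟩)
  rintro p (rfl | hp) q (rfl | hq)
  · simp
  · exact hx q hq
  · have := hx p hp
    rw [← neg_sub x, ← neg_sub (y'.comp L), neg_apply, map_neg, neg_neg]
    exact this
  · exact hA.1 p hp q hq

end Pushforward

end MonotoneOp

/-! ### The operator on the James space: skewness and maximality -/

namespace JamesSpace

open MonotoneOp

theorem tendsto_sum_mul (x : JamesSpace) (y : StrongDual ℝ JamesSpace) :
    Tendsto (fun N => ∑ n ∈ Finset.range N, seq x n * y (unitVec n)) atTop (𝓝 (y x)) := by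
  simpa [Function.comp_def] using (y.continuous.tendsto x).comp (tendsto_sum_unitVec x)

theorem partialSum_add (y z : StrongDual ℝ JamesSpace) (n : ℕ) :
    partialSum (y + z) n = partialSum y n + partialSum z n := by simp [partialSum_eq]

theorem partialSum_sub (y z : StrongDual ℝ JamesSpace) (n : ℕ) :
    partialSum (y - z) n = partialSum y n - partialSum z n := by simp [partialSum_eq]

theorem partialSum_smul (c : ℝ) (y : StrongDual ℝ JamesSpace) (n : ℕ) :
    partialSum (c • y) n = c * partialSum y n := by simp [partialSum_eq]

theorem partialSum_coord (n k : ℕ) : partialSum (coord n) k = if n < k then 1 else 0 := by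
  rw [partialSum_eq, coord_apply, seq_initial]

variable {e : StrongDual ℝ (StrongDual ℝ JamesSpace)}

theorem apply_coord (he : ∀ y, Tendsto (partialSum y) atTop (𝓝 (e y))) (n : ℕ) :
    e (coord n) = 1 := by
  refine tendsto_nhds_unique (he _) (tendsto_const_nhds.congr' ?_)
  filter_upwards [eventually_gt_atTop n] with k hk
  rw [partialSum_coord, if_pos hk]

theorem abs_apply_le (he : ∀ y, Tendsto (partialSum y) atTop (𝓝 (e y)))
    (y : StrongDual ℝ JamesSpace) : |e y| ≤ ‖y‖ :=
  le_of_tendsto (he y).abs (Eventually.of_forall (abs_partialSum_le y))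

/-- With y(e_n) = s_{n+1} - s_n the series for y(x) telescopes to s_N² + c s_N. The case c = 0
serves the operator itself, c = -2e(y) the proof of maximality. -/
theorem apply_eq_of_seq_eq (he : ∀ y, Tendsto (partialSum y) atTop (𝓝 (e y))) {x : JamesSpace}
    {y : StrongDual ℝ JamesSpace} {c : ℝ}
    (h : ∀ n, seq x n = partialSum y n + partialSum y (n + 1) + c) :
    y x = e y ^ 2 + c * e y := by
  refine tendsto_nhds_unique (tendsto_sum_mul x y)
    ((((he y).pow 2).add ((he y).const_mul c)).congr fun N => ?_)
  induction N with
  | zero => simp [partialSum_zero]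
  | succ N ih =>
    rw [Finset.sum_range_succ, ← ih, h, partialSum_succ]
    ring

theorem mem_schauderOperator_iff (he : ∀ y, Tendsto (partialSum y) atTop (𝓝 (e y)))
    {p : JamesSpace × StrongDual ℝ JamesSpace} :
    p ∈ schauderOperator unitVec e ↔
      e p.2 = 0 ∧ ∀ n, seq p.1 n = partialSum p.2 n + partialSum p.2 (n + 1) := by
  refine and_congr_right fun hp => ?_
  -- The tail starts at n + 1 and the full sum is e(y) = 0, hence the limit -s_{n+1}.
  have ht : ∀ n, Tendsto (fun N => ∑ i ∈ Finset.Ioc n N, p.2 (unitVec i)) atTop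
      (𝓝 (-partialSum p.2 (n + 1))) := fun n => by
    have h := ((tendsto_add_atTop_iff_nat 1).2 (he p.2)).sub_const (partialSum p.2 (n + 1))
    rw [hp, zero_sub] at h
    refine h.congr' ?_
    filter_upwards [eventually_ge_atTop n] with N hN
    rw [← Finset.Ico_add_one_add_one_eq_Ioc, Finset.sum_Ico_eq_sub _ (by omega)]
    rfl
  constructor
  · rintro ⟨t, h1, h2⟩ n
    obtain rfl : t = fun n => -partialSum p.2 (n + 1) :=
      funext fun n => tendsto_nhds_unique (h1 n) (ht n)
    have h3 := ((coord n).continuous.tendsto p.1).comp h2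
    refine tendsto_nhds_unique h3 (tendsto_const_nhds.congr' ?_)
    filter_upwards [eventually_gt_atTop n] with N hN
    rw [Function.comp_apply, coord_apply,
      seq_sum_unitVec (fun n => - -partialSum p.2 (n + 1) + ∑ i ∈ Finset.range n, p.2 (unitVec i)),
      if_pos hN, neg_neg, add_comm]
    rfl
  · intro h
    -- The outer series is the basis expansion of `p.1`, so its norm convergence is automatic.
    refine ⟨_, ht, (tendsto_sum_unitVec p.1).congr fun N => ?_⟩
    refine Finset.sum_congr rfl fun n _ => ?_
    rw [h, neg_neg, add_comm]
    rfl

/-- The operator as a linear subspace. -/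
def schauderSubmodule (he : ∀ y, Tendsto (partialSum y) atTop (𝓝 (e y))) :
    Submodule ℝ (JamesSpace × StrongDual ℝ JamesSpace) where
  carrier := schauderOperator unitVec e
  add_mem' {p q} hp hq := by
    rw [mem_schauderOperator_iff he] at hp hq ⊢
    refine ⟨by rw [Prod.snd_add, map_add, hp.1, hq.1, add_zero], fun n => ?_⟩
    simp only [Prod.fst_add, Prod.snd_add, map_add, Pi.add_apply, hp.2, hq.2, partialSum_add]
    ring
  zero_mem' := by
    rw [mem_schauderOperator_iff he]
    simp [partialSum]
  smul_mem' c p hp := by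
    rw [mem_schauderOperator_iff he] at hp ⊢
    refine ⟨by rw [Prod.smul_snd, map_smul, hp.1, smul_zero], fun n => ?_⟩
    simp only [Prod.smul_fst, Prod.smul_snd, map_smul, Pi.smul_apply, hp.2, partialSum_smul,
      smul_eq_mul]
    ring

theorem apply_self_of_mem (he : ∀ y, Tendsto (partialSum y) atTop (𝓝 (e y)))
    {p : JamesSpace × StrongDual ℝ JamesSpace} (hp : p ∈ schauderOperator unitVec e) :
    p.2 p.1 = 0 := by
  rw [mem_schauderOperator_iff he] at hp
  rw [apply_eq_of_seq_eq he (c := 0) (by simpa using hp.2), hp.1]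
  simp

theorem isLinearRelation_schauderOperator (he : ∀ y, Tendsto (partialSum y) atTop (𝓝 (e y))) :
    IsLinearRelation (schauderOperator unitVec e) :=
  ⟨schauderSubmodule he, rfl⟩

theorem isSkew_schauderOperator (he : ∀ y, Tendsto (partialSum y) atTop (𝓝 (e y))) :
    IsSkew (schauderOperator unitVec e) := by
  intro p hp q hq
  have h1 := apply_self_of_mem he ((schauderSubmodule he).add_mem hp hq)
  have h2 := apply_self_of_mem he hp
  have h3 := apply_self_of_mem he hq
  simp only [Prod.fst_add, Prod.snd_add, map_add, add_apply] at h1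
  simp only [neg_apply, NormedSpace.dual_def]
  linarith

theorem isMonotone_schauderOperator (he : ∀ y, Tendsto (partialSum y) atTop (𝓝 (e y))) :
    IsMonotone (schauderOperator unitVec e) := fun _ hp _ hq =>
  (apply_self_of_mem he ((schauderSubmodule he).sub_mem hp hq)).ge

/-- The partial sums of this functional are the indicator of k = n + 1. These pairs are all the test
elements that maximality needs. -/
theorem unitVec_add_mem (he : ∀ y, Tendsto (partialSum y) atTop (𝓝 (e y))) (n : ℕ) :
    (unitVec n + unitVec (n + 1), coord n - coord (n + 1)) ∈ schauderOperator unitVec e := by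
  rw [mem_schauderOperator_iff he]
  refine ⟨by rw [map_sub, apply_coord he, apply_coord he, sub_self], fun k => ?_⟩
  simp only [map_add, Pi.add_apply, seq_unitVec, Pi.single_apply, partialSum_sub, partialSum_coord]
  split_ifs <;> first | omega | norm_num

theorem isMaximallyMonotone_schauderOperator
    (he : ∀ y, Tendsto (partialSum y) atTop (𝓝 (e y))) :
    IsMaximallyMonotone (schauderOperator unitVec e) := by
  refine ⟨isMonotone_schauderOperator he, fun B hB hAB => (Set.Subset.antisymm hAB ?_).symm⟩
  rintro ⟨x, y⟩ hxy
  obtain ⟨h0, h⟩ := annihilates_of_related (A := schauderSubmodule he) (p := (x, y))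
    (fun q hq => apply_self_of_mem he hq) (fun q hq => hB _ hxy _ (hAB hq))
  have hstep : ∀ n, seq x (n + 1) - (partialSum y (n + 1) + partialSum y (n + 2)) =
      seq x n - (partialSum y n + partialSum y (n + 1)) := fun n => by
    have h1 := h _ (unitVec_add_mem he n)
    simp only [map_add, sub_apply, coord_apply] at h1
    rw [partialSum_succ y (n + 1), partialSum_succ y n]
    linarith
  have hconst : ∀ n, seq x n - (partialSum y n + partialSum y (n + 1)) =
      seq x 0 - (partialSum y 0 + partialSum y (0 + 1)) := fun n => by
    induction n with
    | zero => rfl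
    | succ n ih => rw [← ih, ← hstep n]
  -- The constant is found by letting n → ∞, where x_n → 0 and both partial sums tend to e(y).
  have hlim : seq x 0 - (partialSum y 0 + partialSum y (0 + 1)) = -2 * e y := by
    have h1 := (tendsto_seq x).sub ((he y).add ((tendsto_add_atTop_iff_nat 1).2 (he y)))
    simp only [hconst] at h1
    rw [tendsto_nhds_unique tendsto_const_nhds h1]
    ring
  have hx : ∀ n, seq x n = partialSum y n + partialSum y (n + 1) + -2 * e y := fun n => by
    rw [← hlim, ← hconst n]
    ring
  have h2 := apply_eq_of_seq_eq he hx
  -- Here `h2` says y(x) = -e(y)², while `h0` says y(x) ≥ 0.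
  have h3 : e y = 0 := by
    simp only at h0
    nlinarith
  rw [mem_schauderOperator_iff he]
  exact ⟨h3, fun n => by rw [hx, h3]; ring⟩

/-! ### Failure of (BR), of uniqueness and of type (D) -/

theorem not_isTypeBR_schauderOperator (he : ∀ y, Tendsto (partialSum y) atTop (𝓝 (e y))) :
    ¬ IsTypeBR (schauderOperator unitVec e) := by
  intro h
  -- Against every graph point the pairing equals -1 > -2. Yet e has norm at most 1, vanishes on the
  -- range and is 1 at `coord 0`, so the distance from `coord 0` to the range is at least β = 1.
  obtain ⟨⟨b, b'⟩, hb, -, hb'⟩ := h (-unitVec 0) (coord 0) 2 1 (by norm_num) one_pos (by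
    refine lt_of_lt_of_le (b := ((-1 : ℝ) : EReal)) (by norm_cast) ?_
    refine le_iInf₂ fun p hp => EReal.coe_le_coe_iff.2 ?_
    have h1 := apply_self_of_mem he hp
    have h2 := ((mem_schauderOperator_iff he).1 hp).2 0
    rw [partialSum_succ, partialSum_zero] at h2
    simp only [sub_apply, map_sub, map_neg, coord_apply]
    have h3 : seq (unitVec 0) 0 = 1 := by simp [seq_unitVec]
    linarith)
  have h1 := abs_apply_le he (coord 0 - b')
  rw [map_sub, apply_coord he, ((mem_schauderOperator_iff he).1 hb).1, sub_zero, abs_one] at h1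
  linarith

theorem related_apply_zero (he : ∀ y, Tendsto (partialSum y) atTop (𝓝 (e y)))
    {p : JamesSpace × StrongDual ℝ JamesSpace} (hp : p ∈ schauderOperator unitVec e) :
    (NormedSpace.inclusionInDoubleDual ℝ JamesSpace p.1 - e) p.2 = 0 := by
  rw [sub_apply, NormedSpace.dual_def, apply_self_of_mem he hp,
    ((mem_schauderOperator_iff he).1 hp).1, sub_zero]

theorem not_isUnique_schauderOperator (he : ∀ y, Tendsto (partialSum y) atTop (𝓝 (e y))) :
    ¬ IsUnique (schauderOperator unitVec e) := by
  -- Both points pair to 0 with the whole graph, but to -1 with each other.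
  refine not_isUnique (isMonotone_schauderOperator he) (p := (e, 0))
    (q := (e - NormedSpace.inclusionInDoubleDual ℝ JamesSpace (unitVec 0), coord 0))
    (fun r hr => ?_) (fun r hr => ?_) ?_
  · rw [sub_zero, related_apply_zero he hr]
  · have h1 := apply_self_of_mem he hr
    have h2 := (mem_schauderOperator_iff he).1 hr
    have h3 := h2.2 0
    rw [partialSum_succ, partialSum_zero] at h3
    simp only [sub_apply, map_sub, NormedSpace.dual_def, coord_apply,
      apply_coord he, h2.1]
    have h4 : seq (unitVec 0) 0 = 1 := by simp [seq_unitVec]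
    linarith
  · simp [coord_unitVec]

theorem abs_seq_le_of_mem (he : ∀ y, Tendsto (partialSum y) atTop (𝓝 (e y)))
    {p : JamesSpace × StrongDual ℝ JamesSpace} (hp : p ∈ schauderOperator unitVec e) (n : ℕ) :
    |seq p.1 n| ≤ 2 * ‖p.2‖ := by
  rw [((mem_schauderOperator_iff he).1 hp).2]
  refine (abs_add_le _ _).trans ?_
  linarith [abs_partialSum_le p.2 n, abs_partialSum_le p.2 (n + 1)]

theorem not_isTypeD_pushforward (he : ∀ y, Tendsto (partialSum y) atTop (𝓝 (e y)))
    {Y : Type u} [NormedAddCommGroup Y] [NormedSpace ℝ Y] (L : JamesSpace →L[ℝ] Y)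
    (hext : ∀ x' : StrongDual ℝ JamesSpace, ∃ y' : StrongDual ℝ Y, y'.comp L = x') :
    ¬ IsTypeD (pushforward L (schauderOperator unitVec e)) := by
  intro h
  obtain ⟨Γ, _, _, _, a, ha, -, h1, h2⟩ :=
    -- The test point is (L** e, 0), whose pairing with every graph point is 0.
    h (e.comp ((ContinuousLinearMap.compL ℝ JamesSpace Y ℝ).flip L)) 0 (by
      refine le_iInf₂ fun p hp => ?_
      obtain ⟨y, y'⟩ := p
      obtain ⟨x, rfl, hx⟩ := hp
      have h1 := related_apply_zero he hx
      simp only [sub_apply, NormedSpace.dual_def,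
        ContinuousLinearMap.comp_apply] at h1
      simp [h1])
  -- On the graph the extension `g` reads off coordinate 0 of the preimage, which is at most
  -- 2‖y'‖‖L‖ and so tends to 0, whereas L** e takes the value 1 at `g`.
  obtain ⟨g, hg⟩ := hext (coord 0)
  have h3 : Tendsto (fun γ => g (a γ).1) atTop (𝓝 0) := by
    have h4 : Tendsto (fun γ => 2 * (‖(a γ).2‖ * ‖L‖)) atTop (𝓝 0) := by
      simpa using (h2.norm.mul_const ‖L‖).const_mul 2
    refine squeeze_zero_norm (fun γ => ?_) h4
    obtain ⟨x, hx, hxA⟩ := ha γ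
    rw [← hx, Real.norm_eq_abs, ← ContinuousLinearMap.comp_apply, hg, coord_apply]
    exact (abs_seq_le_of_mem he hxA 0).trans
      (mul_le_mul_of_nonneg_left (ContinuousLinearMap.opNorm_comp_le _ _) zero_le_two)
  have h5 := tendsto_nhds_unique h3 (h1 g)
  simp [hg, apply_coord he] at h5

theorem not_isTypeD_schauderOperator (he : ∀ y, Tendsto (partialSum y) atTop (𝓝 (e y))) :
    ¬ IsTypeD (schauderOperator unitVec e) := by
  have h := not_isTypeD_pushforward he (ContinuousLinearMap.id ℝ JamesSpace)
    fun x' => ⟨x', ContinuousLinearMap.comp_id _⟩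
  have hA : pushforward (ContinuousLinearMap.id ℝ JamesSpace) (schauderOperator unitVec e) =
      schauderOperator unitVec e := by
    ext ⟨x, y⟩
    simp [pushforward]
  rwa [hA] at h

theorem not_isSpaceOfTypeD {Y : Type u} [NormedAddCommGroup Y] [NormedSpace ℝ Y]
    {S : Submodule ℝ Y} (f : JamesSpace ≃L[ℝ] S) : ¬ IsSpaceOfTypeD Y := by
  obtain ⟨e, he⟩ := exists_tendsto_partialSum
  let L : JamesSpace →L[ℝ] Y := S.subtypeL.comp (f : JamesSpace →L[ℝ] S)
  have hext : ∀ x' : StrongDual ℝ JamesSpace, ∃ y' : StrongDual ℝ Y, y'.comp L = x' := fun x' => by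
    obtain ⟨g, hg, -⟩ := exists_extension_norm_eq S (x'.comp (f.symm : S →L[ℝ] JamesSpace))
    refine ⟨g, ContinuousLinearMap.ext fun x => ?_⟩
    exact (hg (f x)).trans (by simp)
  have hrange : L.range = S := by
    ext y
    refine ⟨?_, fun hy => ⟨f.symm ⟨y, hy⟩, by simp [L]⟩⟩
    rintro ⟨x, rfl⟩
    exact (f x).2
  have hclosed : IsClosed (S : Set Y) := by
    -- A linear homeomorphism transfers completeness, so the copy is closed in `Y`.
    have : CompleteSpace S := (completeSpace_congr (e := f.toEquiv) f.isUniformEmbedding).1 inferInstance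
    exact (completeSpace_coe_iff_isComplete.1 this).isClosed
  intro h
  refine not_isTypeD_pushforward he L hext (h _ ?_)
  exact (isMaximallyMonotone_schauderOperator he).pushforward
    ⟨0, (schauderSubmodule he).zero_mem⟩ L (by rwa [hrange]) hext

end JamesSpace

end

open MonotoneOp in
theorem corollary4p10 :
    (∃ b : SchauderBasis ℝ JamesSpace, ∀ n, b n = JamesSpace.unitVec n) ∧
    (∃ e : StrongDual ℝ (StrongDual ℝ JamesSpace),
      (∀ y' : StrongDual ℝ JamesSpace,
        Tendsto (fun N => ∑ i ∈ Finset.range N, y' (JamesSpace.unitVec i)) atTop (𝓝 (e y'))) ∧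
      IsMaximallyMonotone (schauderOperator JamesSpace.unitVec e) ∧
      IsLinearRelation (schauderOperator JamesSpace.unitVec e) ∧
      IsSkew (schauderOperator JamesSpace.unitVec e) ∧
      ¬ IsTypeBR (schauderOperator JamesSpace.unitVec e) ∧
      ¬ IsUnique (schauderOperator JamesSpace.unitVec e) ∧
      ¬ IsTypeD (schauderOperator JamesSpace.unitVec e)) ∧
    (∀ (Y : Type u) [NormedAddCommGroup Y] [NormedSpace ℝ Y] [CompleteSpace Y],
      (∃ S : Submodule ℝ Y, Nonempty (JamesSpace ≃L[ℝ] S)) → ¬ IsSpaceOfTypeD Y) := by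
  refine ⟨⟨JamesSpace.schauderBasis, fun _ => rfl⟩, ?_, ?_⟩
  · obtain ⟨e, he⟩ := JamesSpace.exists_tendsto_partialSum
    exact ⟨e, he, JamesSpace.isMaximallyMonotone_schauderOperator he,
      JamesSpace.isLinearRelation_schauderOperator he, JamesSpace.isSkew_schauderOperator he,
      JamesSpace.not_isTypeBR_schauderOperator he, JamesSpace.not_isUnique_schauderOperator he,
      JamesSpace.not_isTypeD_schauderOperator he⟩
  · rintro Y _ _ _ ⟨S, ⟨f⟩⟩
    exact JamesSpace.not_isSpaceOfTypeD f
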